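/- Fix a rational $r\in(0,1)$. For a finite graph $A$ put $\delta(A)=|A|-r\,e(A)$, where $e(A)$ is the number of edges of $A$, and for $A\subseteq B$ (induced subgraph) put $\delta(B/A)=\delta(B)-\delta(A)$. Let $K_r^+$ be the class of finite graphs all of whose nonempty induced subgraphs have $\delta>0$; for $A\subseteq B$ in $K_r^+$ write $A\preccurlyeq_r B$ if $\delta(B_0/A)>0$ whenever $A\subsetneq B_0\subseteq B$. In a class with a relation $\preccurlyeq$, $(A,B)$ is a minimal pair if $A\subseteq B$, $A\not\preccurlyeq B$, and $A\preccurlyeq B_0$ whenever $A\subseteq B_0\subsetneq B$. For $X\subseteq Z\in K_r^+$, $(X,Z)$ is a $0$-extension if there is a chain $X=X_0\subseteq\dots\subseteq X_k=Z$ of minimal pairs $(X_i,X_{i+1})$ for $\preccurlyeq_r$ with $\delta(X_{i+1}/X_i)=0$. It is proper if moreover there is no $X_0\subsetneq X$ for which $(X_0,X_0\cup(Z\setminus X))$ is a $0$-extension, and $Z\setminus X$ is not the disjoint union of two nonempty sets with no edge between them. Let $\gamma$ be the largest number such that $\delta(B/A)\le-\gamma$ whenever $A\subseteq B\in K_r^+$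 and $\delta(B/A)<0$. Let $\mu$ be any real-valued function of pairs of members of $K_r^+$ with $\mu(X,Y)\ge 2(\delta(X)+\delta(Y))/\gamma$, and let $\nu(X)=\max\{\mu(X_0,X_1): X=X_0\sqcup X_1\}$, the maximum being over partitions of the vertex set of $X$ into two (possibly empty) parts with their induced graphs. Let $L^*$ be the language of graphs with one more binary relation symbol $S$, and let $N>1$ be an integer. A set is $S$-homogeneous if any two of its elements are $S$-related. Let $K_r^*$ be the class of finite $L^*$-structures $A$ such that (1) the graph reduct of $A$ is in $K_r^+$; (2) $S$ is an equivalence relation on $A$ with all classes of size less than $N$; (3) if $X\subseteq A$ is not $S$-homogeneous and $(X,Y)$ is a proper $0$-extension, then $A$ contains at most $\nu(X)$ copies of $Y$ over $X$ (images of graph isomorphisms fixing $X$ pointwise) that are pairwise disjoint outside $X$. For $A,B\in K_r^*$ write $A\preccurlyeq^*B$ if $A\subseteq B$, every $S$-homogeneous $X\subseteq B$ satisfies $X\subseteq A$ or $X\subseteq B\setminus A$, and the graph reducts satisfy $A\preccurlyeq_r B$. For a finite subset $A$ of an $L^*$-structure $M$ all of whose finite substructures are in $K_r^*$, write $A\preccurlyeq^*M$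 if $A\preccurlyeq^*B$ for all finite $B$ with $A\subseteq B\subseteq M$; the closure of $A$ in $M$ is the smallest $P\supseteq A$ that contains $B$ for every minimal pair $(A_0,B)$ for $\preccurlyeq^*$ in $M$ with $A_0\subseteq P$ finite. A $(K_r^*,\preccurlyeq^*)$-generic is a countable $L^*$-structure $M$ such that every finite substructure of $M$ is in $K_r^*$; whenever $A\preccurlyeq^* M$ is finite and $A\preccurlyeq^* B\in K_r^*$ there is an embedding $g:B\to M$ over $A$ with $g(B)\preccurlyeq^* M$; and the closure in $M$ of every finite set is finite. **Proposition.** For every rational $r\in(0,1)$ there is an $N_r$ such that for every integer $N>1$ with $N>N_r$, every $\mu$ as above and every $(K_r^*,\preccurlyeq^*)$-generic $M$ (formed with $N$ and $\mu$), the complete theory of $M$ has the independence property: there is an $L^*$-formula $\varphi(\bar x,\bar y)$ such that for every $n$ some model of the theory contains tuples $(\bar b_i)_{i<n}$ and $(\bar a_\eta)_{\eta\subseteq n}$ with $\varphi(\bar a_\eta,\bar b_i)$ true exactly when $i\in\eta$. In particular the theory is unstable: some formula $\varphi(\bar x,\bar y)$ has the order property, i.e. for every $n$ some model contains $(\bar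 a_i)_{i<n}$, $(\bar b_j)_{j<n}$ with $\varphi(\bar a_i,\bar b_j)$ true exactly when $i<j$. -/

import Mathlib

open scoped FirstOrder

/-! ### Predimension on graphs -/

/-- The number of edges of `G` with both endpoints in `A`. -/
noncomputable def edgeCount {V : Type} (G : SimpleGraph V) (A : Finset V) : ℕ :=
  {e : Sym2 V | e ∈ G.edgeSet ∧ ∀ v ∈ e, v ∈ A}.ncard

/-- The predimension `δ_α(A) = |A| - α e(A)` of the induced graph on `A`. -/
noncomputable def predim (α : ℝ) {V : Type} (G : SimpleGraph V) (A : Finset V) : ℝ :=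
  (A.card : ℝ) - α * (edgeCount G A : ℝ)

/-- The induced graph on `A` belongs to `K_α⁺`: every nonempty subset has positive predimension. -/
def InKPlus (α : ℝ) {V : Type} (G : SimpleGraph V) (A : Finset V) : Prop :=
  ∀ A' ⊆ A, A'.Nonempty → 0 < predim α G A'

/-- The relation `A ≼_α B` between finite sets of vertices (with their induced graphs). -/
def GraphStrong (α : ℝ) {V : Type} (G : SimpleGraph V) (A B : Finset V) : Prop :=
  A ⊆ B ∧ ∀ B₀, A ⊂ B₀ → B₀ ⊆ B → 0 < predim α G B₀ - predim α G A

/-- `(A, B)` is a minimal pair for the strong-substructure relation `le`. -/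
def IsMinimalPair {V : Type} (le : Finset V → Finset V → Prop) (A B : Finset V) : Prop :=
  A ⊆ B ∧ ¬ le A B ∧ ∀ B₀, A ⊆ B₀ → B₀ ⊂ B → le A B₀

/-- `(X, Z)` is a `0`-extension: `Z ∈ K_α⁺` and there is a chain `X = X₀ ⊆ ⋯ ⊆ X_k = Z` of minimal
pairs of relative predimension `0`. -/
def IsZeroExt (α : ℝ) {V : Type} (G : SimpleGraph V) (X Z : Finset V) : Prop :=
  InKPlus α G Z ∧
    Relation.ReflTransGen
      (fun P Q => IsMinimalPair (GraphStrong α G) P Q ∧ predim α G Q - predim α G P = 0) X Z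

open Classical in
/-- `(X, Z)` is a proper `0`-extension: the set `Z \ X` of new vertices is not already a
`0`-extension of a proper subset of `X`, and it does not split into two nonempty parts that are
freely joined over `X`. -/
def IsProperZeroExt (α : ℝ) {V : Type} (G : SimpleGraph V) (X Z : Finset V) : Prop :=
  IsZeroExt α G X Z ∧
    (∀ X₀, X₀ ⊂ X → ¬ IsZeroExt α G X₀ (X₀ ∪ (Z \ X))) ∧
    ¬ ∃ Z₀ Z₁ : Finset V, Z₀.Nonempty ∧ Z₁.Nonempty ∧ Disjoint Z₀ Z₁ ∧ Z₀ ∪ Z₁ = Z \ X ∧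
      ∀ u ∈ Z₀, ∀ v ∈ Z₁, ¬ G.Adj u v

/-- `Y'` is a copy of `Y` over `X`: some isomorphism of the induced graphs fixes `X` pointwise. -/
def IsCopyOver {V : Type} (G : SimpleGraph V) (X Y Y' : Finset V) : Prop :=
  X ⊆ Y ∧ X ⊆ Y' ∧
    ∃ f : G.induce (Y : Set V) ≃g G.induce (Y' : Set V),
      ∀ v (hv : v ∈ (Y : Set V)), v ∈ X → ((f ⟨v, hv⟩ : (Y' : Set V)) : V) = v

/-- The granularity `γ` of `K_α⁺`: the largest `g` such that `δ(B/A) ≤ -g` whenever `A ⊆ B` in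
`K_α⁺` and `δ(B/A) < 0`. -/
noncomputable def granularity (α : ℝ) : ℝ :=
  sSup {g : ℝ | ∀ (V : Type) (G : SimpleGraph V) (A B : Finset V), A ⊆ B → InKPlus α G B →
    predim α G B - predim α G A < 0 → predim α G B - predim α G A ≤ -g}

/-- A real function of two graphs, to be used on members of `K_α⁺`. -/
abbrev GraphPairFun : Type 1 := ∀ ⦃V W : Type⦄, SimpleGraph V → SimpleGraph W → ℝ

/-- The requirement on `μ`: `μ(X, Y) ≥ 2 (δ(X) + δ(Y)) / γ` for all `X, Y ∈ K_α⁺`. -/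
def IsMuFunction (α : ℝ) (μ : GraphPairFun) : Prop :=
  ∀ (V W : Type) [Fintype V] [Fintype W] (G : SimpleGraph V) (H : SimpleGraph W),
    InKPlus α G Finset.univ → InKPlus α H Finset.univ →
      2 * (predim α G Finset.univ + predim α H Finset.univ) / granularity α ≤ μ G H

open Classical in
/-- `ν(X)`: the maximum of `μ(X₀, X₁)` over all partitions `X = X₀ ⊔ X₁`. -/
noncomputable def nu (μ : GraphPairFun) {V : Type} (G : SimpleGraph V) (X : Finset V) : ℝ :=
  X.powerset.sup' ⟨∅, Finset.empty_mem_powerset X⟩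
    (fun X₀ => μ (G.induce (X₀ : Set V)) (G.induce ((X \ X₀ : Finset V) : Set V)))

/-! ### The language of graphs with an additional binary relation `S` -/

/-- The relation symbols: adjacency and `S`, both binary. -/
inductive GSRel : ℕ → Type
  | adj : GSRel 2
  | cls : GSRel 2

/-- The language of graphs expanded by a binary relation symbol `S`. -/
def LStar : FirstOrder.Language.{0, 0} := ⟨fun _ => Empty, GSRel⟩

/-- The interpretation of adjacency. -/
def adjRel {V : Type} [LStar.Structure V] (x y : V) : Prop :=
  FirstOrder.Language.Structure.RelMap (L := LStar) GSRel.adj ![x, y]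

/-- The interpretation of `S`. -/
def clsRel {V : Type} [LStar.Structure V] (x y : V) : Prop :=
  FirstOrder.Language.Structure.RelMap (L := LStar) GSRel.cls ![x, y]

/-- The graph reduct. (Wherever adjacency is symmetric and irreflexive, which admissibility
demands, this is exactly the interpretation of the adjacency symbol.) -/
def graphOf (V : Type) [LStar.Structure V] : SimpleGraph V := SimpleGraph.fromRel adjRel

/-- `X` is `S`-homogeneous: all its elements are in the same `S`-class. -/
def IsHomogeneous {V : Type} [LStar.Structure V] (X : Finset V) : Prop :=
  ∀ x ∈ X, ∀ y ∈ X, clsRel x y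

open Classical in
/-- The `LStar`-structure induced on the finite set `A` is admissible, i.e. belongs to `K_α^*`
(formed with the parameters `N` and `μ`). -/
structure IsAdmissible (α : ℝ) (N : ℕ) (μ : GraphPairFun) {V : Type} [LStar.Structure V]
    (A : Finset V) : Prop where
  adj_irrefl : ∀ x ∈ A, ¬ adjRel x x
  adj_symm : ∀ x ∈ A, ∀ y ∈ A, adjRel x y → adjRel y x
  inKPlus : InKPlus α (graphOf V) A
  cls_refl : ∀ x ∈ A, clsRel x x
  cls_symm : ∀ x ∈ A, ∀ y ∈ A, clsRel x y → clsRel y x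
  cls_trans : ∀ x ∈ A, ∀ y ∈ A, ∀ z ∈ A, clsRel x y → clsRel y z → clsRel x z
  cls_card : ∀ x ∈ A, (A.filter (fun y => clsRel x y)).card < N
  /-- Over a non-homogeneous `X`, a proper `0`-extension has at most `ν(X)` copies in `A` that are
  pairwise disjoint over `X`. -/
  copies_le : ∀ X ⊆ A, ¬ IsHomogeneous X → ∀ Y ⊆ A, IsProperZeroExt α (graphOf V) X Y →
    ∀ F : Finset (Finset V), (∀ Y' ∈ F, Y' ⊆ A ∧ IsCopyOver (graphOf V) X Y Y') →
      (∀ Y' ∈ F, ∀ Y'' ∈ F, Y' ≠ Y'' → Y' ∩ Y'' = X) →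
        (F.card : ℝ) ≤ nu μ (graphOf V) X

/-- The relation `A ≼^* B` between finite subsets of an `LStar`-structure. -/
def IsStrong (α : ℝ) {V : Type} [LStar.Structure V] (A B : Finset V) : Prop :=
  A ⊆ B ∧ (∀ X ⊆ B, IsHomogeneous X → X ⊆ A ∨ Disjoint X A) ∧ GraphStrong α (graphOf V) A B

/-- `A ≼^* M` for a finite subset `A` of a possibly infinite structure `M`. -/
def IsStrongIn (α : ℝ) {M : Type} [LStar.Structure M] (A : Finset M) : Prop :=
  ∀ B : Finset M, A ⊆ B → IsStrong α A B

/-- `P ≼^* M` for an arbitrary subset `P` of `M`: closure under minimal pairs. -/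
def IsClosedSet (α : ℝ) {M : Type} [LStar.Structure M] (P : Set M) : Prop :=
  ∀ A B : Finset M, (A : Set M) ⊆ P → IsMinimalPair (IsStrong α) A B → (B : Set M) ⊆ P

/-- The closure of `A` in `M`: the smallest closed set containing `A`. -/
def closureIn (α : ℝ) {M : Type} [LStar.Structure M] (A : Set M) : Set M :=
  ⋂₀ {P : Set M | A ⊆ P ∧ IsClosedSet α P}

/-- `M` is a `(K_α^*, ≼^*)`-generic. -/
structure IsGeneric (α : ℝ) (N : ℕ) (μ : GraphPairFun) (M : Type) [LStar.Structure M] : Prop where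
  countable : Countable M
  mem_class : ∀ A : Finset M, IsAdmissible α N μ A
  extension : ∀ (A B : Type) [Fintype A] [Fintype B] [LStar.Structure A] [LStar.Structure B]
    (i : A ↪[LStar] M) (f : A ↪[LStar] B),
    IsAdmissible α N μ (Finset.univ : Finset B) →
    IsStrongIn α (Finset.univ.map i.toEmbedding) →
    IsStrong α (Finset.univ.map f.toEmbedding) Finset.univ →
      ∃ g : B ↪[LStar] M, IsStrongIn α (Finset.univ.map g.toEmbedding) ∧ ∀ a, g (f a) = i a
  closure_finite : ∀ A : Finset M, (closureIn α (A : Set M)).Finite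

/-! ### The independence property and stability -/

/-- `φ(x, y)` has the independence property in `T`: for every `n`, some model of `T` contains
`(b_i)_{i < n}` and `(a_η)_{η ⊆ n}` such that `φ(a_η, b_i)` holds exactly when `i ∈ η`. -/
def FormulaHasIP {L : FirstOrder.Language.{0, 0}} (T : L.Theory) {k l : ℕ}
    (φ : L.Formula (Fin k ⊕ Fin l)) : Prop :=
  ∀ n : ℕ, ∃ (M : FirstOrder.Language.Theory.ModelType.{0, 0, 0} T)
    (a : Set (Fin n) → Fin k → M) (b : Fin n → Fin l → M),
    ∀ η i, φ.Realize (Sum.elim (a η) (b i)) ↔ i ∈ η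

/-- `T` has the independence property: some formula has it. -/
def HasIndependenceProperty {L : FirstOrder.Language.{0, 0}} (T : L.Theory) : Prop :=
  ∃ (k l : ℕ) (φ : L.Formula (Fin k ⊕ Fin l)), FormulaHasIP T φ

/-- `φ(x, y)` has the order property in `T`. -/
def FormulaHasOP {L : FirstOrder.Language.{0, 0}} (T : L.Theory) {k l : ℕ}
    (φ : L.Formula (Fin k ⊕ Fin l)) : Prop :=
  ∀ n : ℕ, ∃ (M : FirstOrder.Language.Theory.ModelType.{0, 0, 0} T)
    (a : Fin n → Fin k → M) (b : Fin n → Fin l → M),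
    ∀ i j, φ.Realize (Sum.elim (a i) (b j)) ↔ i < j

/-- `T` is stable: no formula has the order property. -/
def IsStableTheory {L : FirstOrder.Language.{0, 0}} (T : L.Theory) : Prop :=
  ∀ (k l : ℕ) (φ : L.Formula (Fin k ⊕ Fin l)), ¬ FormulaHasOP T φ

/-! Write `r = p/q` in lowest terms. The generic strongly embeds every finite member of the class,
because the empty set is strong (`IsGeneric.exists_strong_embedding`). It therefore suffices to code
an arbitrary finite graph `R` in a member of the class so that a fixed formula still reads off
adjacency inside `M`.

Each vertex of `R` becomes a base of `q` points. Each ordered pair `(c, d)` gets a gadget of `p`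
nodes and `q` edges over the base of `c`, so its relative predimension is `p - r q = 0`. The edges
of `R` are recorded only by `S`, which links the gadgets `(c, d)` and `(d, c)` node by node when `c`
and `d` are adjacent.

Gadgets are balanced: a set `I` of nodes contains both end nodes of at most `(q/p)|I|` gadget edges
and is touched by at least that many. The upper bound gives `δ ≥ 1` on nonempty sets with a base
point; sets of nodes alone are forests. The lower bound shows that a strong set containing a base
contains every gadget over it in `M` (`IsGadget.mem`), so existential quantification over gadgets
creates no new codes (`areCoded_base_iff`).

The bound on copies holds because a non-homogeneous `X` with a proper `0`-extension contains a node,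
and nodes have degree at most `q`. Since `γ = 1/q` and `δ(X) ≥ 1`, the value `ν(X)` is at least
`2q`. Coding the membership graph between subsets and elements of an `n`-set gives the independence
property. -/

/-! ### Edges and predimension of finite vertex sets -/

/-- The edges of `G` with both endpoints in `A`. -/
def edgesIn {V : Type} (G : SimpleGraph V) (A : Finset V) : Set (Sym2 V) :=
  {e | e ∈ G.edgeSet ∧ ∀ v ∈ e, v ∈ A}

theorem edgeCount_eq {V : Type} (G : SimpleGraph V) (A : Finset V) :
    edgeCount G A = (edgesIn G A).ncard := rfl

theorem mk_mem_edgesIn {V : Type} {G : SimpleGraph V} {A : Finset V} {u v : V} :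
    s(u, v) ∈ edgesIn G A ↔ G.Adj u v ∧ u ∈ A ∧ v ∈ A := by
  simp [edgesIn]

theorem finite_edgesIn {V : Type} (G : SimpleGraph V) (A : Finset V) : (edgesIn G A).Finite := by
  classical
  refine (Finset.finite_toSet ((A ×ˢ A).image fun x => s(x.1, x.2))).subset ?_
  intro e
  induction e with
  | h u v =>
    intro h
    rw [mk_mem_edgesIn] at h
    simp only [Finset.coe_image, Set.mem_image]
    exact ⟨(u, v), by simp [h.2.1, h.2.2], rfl⟩

theorem edgeCount_le_card {V ι : Type} (G : SimpleGraph V) (A : Finset V) (s : Finset ι)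
    (f : ι → Sym2 V) (h : ∀ e ∈ edgesIn G A, ∃ i ∈ s, f i = e) : edgeCount G A ≤ s.card := by
  classical
  rw [edgeCount_eq]
  calc (edgesIn G A).ncard ≤ ((s.image f : Finset (Sym2 V)) : Set (Sym2 V)).ncard :=
        Set.ncard_le_ncard (fun e he => by simpa using h e he) (Finset.finite_toSet _)
    _ = (s.image f).card := Set.ncard_coe_finset _
    _ ≤ s.card := Finset.card_image_le

theorem card_le_edgeCount {V ι : Type} (G : SimpleGraph V) (A B : Finset V) (hAB : A ⊆ B)
    (s : Finset ι) (f : ι → Sym2 V) (hf : Set.InjOn f s)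
    (h : ∀ i ∈ s, f i ∈ edgesIn G B ∧ f i ∉ edgesIn G A) :
    edgeCount G A + s.card ≤ edgeCount G B := by
  classical
  rw [edgeCount_eq, edgeCount_eq, ← Finset.card_image_of_injOn hf, ← Set.ncard_coe_finset,
    ← Set.ncard_union_eq _ (finite_edgesIn G A) (Finset.finite_toSet _)]
  · refine Set.ncard_le_ncard ?_ (finite_edgesIn G B)
    rintro e (he | he)
    · exact ⟨he.1, fun v hv => hAB (he.2 v hv)⟩
    · obtain ⟨i, hi, rfl⟩ := by simpa using he
      exact (h i hi).1
  · rw [Set.disjoint_left]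
    intro e he he'
    obtain ⟨i, hi, rfl⟩ := by simpa using he'
    exact (h i hi).2 he

theorem predim_empty {V : Type} (α : ℝ) (G : SimpleGraph V) : predim α G ∅ = 0 := by
  have h : edgeCount G ∅ ≤ (∅ : Finset (Sym2 V)).card :=
    edgeCount_le_card G _ _ id fun e => by
      induction e with
      | h u v => simp [mk_mem_edgesIn]
  rw [Finset.card_empty, Nat.le_zero] at h
  simp [predim, h]

theorem predim_map {V W : Type} (α : ℝ) (G : SimpleGraph W) (f : V ↪ W) (A : Finset V) :
    predim α G (A.map f) = predim α (G.comap f) A := by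
  have : edgesIn G (A.map f) = Sym2.map f '' edgesIn (G.comap f) A := by
    ext e
    induction e with
    | h u v =>
      rw [mk_mem_edgesIn]
      constructor
      · rintro ⟨h, hu, hv⟩
        obtain ⟨a, ha, rfl⟩ := Finset.mem_map.1 hu
        obtain ⟨b, hb, rfl⟩ := Finset.mem_map.1 hv
        exact ⟨s(a, b), mk_mem_edgesIn.2 ⟨h, ha, hb⟩, by simp⟩
      · rintro ⟨e, he, h⟩
        induction e with
        | h a b =>
          rw [mk_mem_edgesIn] at he
          rw [Sym2.map_mk, Sym2.eq_iff] at h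
          rcases h with ⟨rfl, rfl⟩ | ⟨rfl, rfl⟩
          · exact ⟨he.1, Finset.mem_map_of_mem _ he.2.1, Finset.mem_map_of_mem _ he.2.2⟩
          · exact ⟨he.1.symm, Finset.mem_map_of_mem _ he.2.2, Finset.mem_map_of_mem _ he.2.1⟩
  rw [predim, predim, Finset.card_map, edgeCount_eq, edgeCount_eq, this,
    Set.ncard_image_of_injective _ (Sym2.map.injective f.injective)]

theorem predim_induce_univ {V : Type} (α : ℝ) (G : SimpleGraph V) (A : Finset V)
    [Fintype (A : Set V)] :
    predim α (G.induce (A : Set V)) Finset.univ = predim α G A := by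
  have := predim_map α G (Function.Embedding.subtype (· ∈ (A : Set V))) Finset.univ
  rw [← SimpleGraph.induce] at this
  rw [← this]
  congr 1
  ext v
  simp

theorem InKPlus.induce {V : Type} {α : ℝ} {G : SimpleGraph V} {A : Finset V} (h : InKPlus α G A)
    [Fintype (A : Set V)] : InKPlus α (G.induce (A : Set V)) Finset.univ := by
  intro W _ hW
  have := predim_map α G (Function.Embedding.subtype (· ∈ (A : Set V))) W
  rw [← SimpleGraph.induce] at this
  rw [← this]
  refine h _ ?_ (hW.map)
  intro v hv
  obtain ⟨w, -, rfl⟩ := Finset.mem_map.1 hv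
  exact w.2

theorem InKPlus.mono {V : Type} {α : ℝ} {G : SimpleGraph V} {A B : Finset V} (h : InKPlus α G B)
    (hAB : A ⊆ B) : InKPlus α G A := fun _ hW hne => h _ (hW.trans hAB) hne

theorem le_nu {V : Type} {α : ℝ} {μ : GraphPairFun} (hμ : IsMuFunction α μ) (G : SimpleGraph V)
    (X : Finset V) (hX : InKPlus α G X) :
    2 * predim α G X / granularity α ≤ nu μ G X := by
  classical
  -- Use the partition of `X` into `X` and the empty set.
  refine le_trans ?_ (Finset.le_sup' _ (Finset.mem_powerset_self X))
  have h1 := hμ (X : Set V) ((X \ X : Finset V) : Set V) (G.induce _) (G.induce _) hX.induce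
    (InKPlus.induce (hX.mono Finset.sdiff_subset))
  rw [predim_induce_univ, predim_induce_univ] at h1
  have h0 : predim α G (X \ X) = 0 := by rw [Finset.sdiff_self]; exact predim_empty α G
  rw [h0, add_zero] at h1
  exact h1

/-! ### Granularity -/

/-- A path on `{0, …, k - 1}` with all further natural numbers attached to its last vertex. -/
def broom (k : ℕ) : SimpleGraph ℕ := SimpleGraph.fromRel fun a b => 1 ≤ b ∧ a = min (b - 1) (k - 1)

theorem mem_edgesIn_broom {k : ℕ} {A : Finset ℕ} {e : Sym2 ℕ} (he : e ∈ edgesIn (broom k) A) :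
    ∃ b ∈ A, 1 ≤ b ∧ min (b - 1) (k - 1) ∈ A ∧ s(min (b - 1) (k - 1), b) = e := by
  induction e with
  | h u v =>
    obtain ⟨⟨-, ⟨h, rfl⟩ | ⟨h, rfl⟩⟩, hu, hv⟩ := mk_mem_edgesIn.1 he
    · exact ⟨v, hv, h, hu, rfl⟩
    · exact ⟨u, hu, h, hv, Sym2.eq_swap⟩

theorem inKPlus_broom {α : ℝ} (h1 : α < 1) (h0 : 0 ≤ α) (k : ℕ) (A : Finset ℕ) :
    InKPlus α (broom k) A := by
  intro W _ hW
  have h : edgeCount (broom k) W ≤ W.card :=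
    edgeCount_le_card _ _ W (fun b => s(min (b - 1) (k - 1), b)) fun e he => by
      obtain ⟨b, hb, -, -, h⟩ := mem_edgesIn_broom he
      exact ⟨b, hb, h⟩
  have h' : (edgeCount (broom k) W : ℝ) ≤ W.card := by exact_mod_cast h
  have hc : (0 : ℝ) < W.card := by exact_mod_cast hW.card_pos
  rw [predim]
  nlinarith

theorem edgeCount_broom_range (k m : ℕ) : edgeCount (broom k) (Finset.range (m + 1)) = m := by
  apply le_antisymm
  · have := edgeCount_le_card (broom k) (Finset.range (m + 1)) (Finset.Ico 1 (m + 1))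
      (fun b => s(min (b - 1) (k - 1), b)) fun e he => by
        obtain ⟨b, hb, h1, -, h⟩ := mem_edgesIn_broom he
        exact ⟨b, by simp at hb ⊢; omega, h⟩
    simpa using this
  · have := card_le_edgeCount (broom k) ∅ (Finset.range (m + 1)) (by simp) (Finset.Ico 1 (m + 1))
      (fun b => s(min (b - 1) (k - 1), b)) (by
        intro a ha b hb hab
        simp only [Finset.coe_Ico, Set.mem_Ico] at ha hb
        simp only [Sym2.eq_iff] at hab
        omega) (by
        intro b hb
        simp only [Finset.mem_Ico] at hb
        refine ⟨mk_mem_edgesIn.2 ⟨⟨by omega, Or.inl ⟨hb.1, rfl⟩⟩, ?_, ?_⟩, ?_⟩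
        · simp; omega
        · simp; omega
        · simp [mk_mem_edgesIn])
    simp at this
    omega

theorem edgeCount_broom_Ico (k m : ℕ) (hk : 1 ≤ k) : edgeCount (broom k) (Finset.Ico k m) = 0 := by
  have := edgeCount_le_card (broom k) (Finset.Ico k m) (∅ : Finset ℕ)
    (fun b => s(min (b - 1) (k - 1), b)) fun e he => by
      obtain ⟨b, hb, h1, h2, h⟩ := mem_edgesIn_broom he
      simp at h2
      omega
  simpa using this

/-- Relative predimensions are integer multiples of `1/q`, so negative ones are at most `-1/q`. A
broom attains this value: `k` handle vertices carrying `l` edges contribute `k - (p/q) l`, with `p l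
= k q + 1`. -/
theorem granularity_eq {p q : ℕ} (hp : 0 < p) (hpq : p < q) (hco : p.Coprime q) :
    granularity ((p : ℝ) / q) = 1 / q := by
  have hq : (0 : ℝ) < q := by exact_mod_cast hp.trans hpq
  have hα1 : (p : ℝ) / q < 1 := by rw [div_lt_one hq]; exact_mod_cast hpq
  have hα0 : 0 ≤ (p : ℝ) / q := by positivity
  refine IsGreatest.csSup_eq ⟨?_, ?_⟩
  · intro V G A B _ _ h
    have key : predim ((p : ℝ) / q) G B - predim ((p : ℝ) / q) G A
        = (((B.card - A.card : ℤ) * q - p * (edgeCount G B - edgeCount G A) : ℤ) : ℝ) / q := by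
      rw [predim, predim]
      push_cast
      field_simp
      ring
    rw [key] at h ⊢
    rw [div_lt_iff₀ hq, zero_mul] at h
    have h' := Int.cast_lt_zero.1 h
    rw [← neg_div, div_le_div_iff_of_pos_right hq]
    have : ((B.card - A.card : ℤ) * q - p * (edgeCount G B - edgeCount G A) : ℤ) ≤ -1 := by omega
    exact_mod_cast this
  · intro g hg
    obtain ⟨m, -, hm⟩ := Nat.exists_mul_mod_eq_one_of_coprime hco (by omega)
    have hm' := Nat.div_add_mod (p * m) q
    rw [hm] at hm'
    obtain ⟨k, l, hk, hkl⟩ : ∃ k l : ℕ, 1 ≤ k ∧ p * l = k * q + 1 :=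
      -- Adding `(p, q)` to a solution `(k, l)` gives another; this one has `k ≥ 1`, so the handle
      -- is nonempty.
      ⟨p * m / q + p, m + q, hp.trans_le (Nat.le_add_left _ _), by
        rw [mul_add, add_mul]; linarith⟩
    have hlk : k ≤ l := by
      by_contra h
      have h2 : p * l ≤ q * k := Nat.mul_le_mul hpq.le (by omega)
      have h3 : q * k = k * q := mul_comm _ _
      omega
    have hkl' : (p : ℝ) * l = k * q + 1 := by exact_mod_cast hkl
    have key : predim ((p : ℝ) / q) (broom k) (Finset.range (l + 1))
        - predim ((p : ℝ) / q) (broom k) (Finset.Ico k (l + 1)) = - (1 / q) := by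
      rw [predim, predim, edgeCount_broom_range, edgeCount_broom_Ico _ _ hk, Finset.card_range,
        Nat.card_Ico, Nat.cast_sub (by omega)]
      push_cast
      field_simp
      linarith
    have := hg ℕ (broom k) (Finset.Ico k (l + 1)) (Finset.range (l + 1))
      (fun x hx => by simp at hx ⊢; omega) (inKPlus_broom hα1 hα0 _ _)
      (by rw [key]; simpa using hq)
    rw [key] at this
    linarith

/-! ### Proper `0`-extensions -/

/-- Every edge at `x` inside `Y` already lies in `X`, so deleting `x` from any intermediate set
loses the same edges. -/
theorem predim_sub_predim_erase {V : Type} [DecidableEq V] (α : ℝ) {G : SimpleGraph V}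
    {X Y P : Finset V} {x : V} (hno : ∀ v ∈ Y, G.Adj x v → v ∈ X) (hx : x ∈ X)
    (hXP : X ⊆ P) (hPY : P ⊆ Y) :
    predim α G P - predim α G (P.erase x) = predim α G X - predim α G (X.erase x) := by
  have h1 : edgesIn G P = edgesIn G (P.erase x) ∪ edgesIn G X := by
    ext e
    induction e with
    | h u v =>
      simp only [Set.mem_union, mk_mem_edgesIn, Finset.mem_erase]
      constructor
      · rintro ⟨h, hu, hv⟩
        by_cases hux : u = x
        · subst hux
          exact Or.inr ⟨h, hx, hno v (hPY hv) h⟩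
        by_cases hvx : v = x
        · subst hvx
          exact Or.inr ⟨h, hno u (hPY hu) h.symm, hx⟩
        exact Or.inl ⟨h, ⟨hux, hu⟩, hvx, hv⟩
      · rintro (⟨h, hu, hv⟩ | ⟨h, hu, hv⟩)
        · exact ⟨h, hu.2, hv.2⟩
        · exact ⟨h, hXP hu, hXP hv⟩
  have h2 : edgesIn G (X.erase x) = edgesIn G (P.erase x) ∩ edgesIn G X := by
    ext e
    induction e with
    | h u v =>
      simp only [Set.mem_inter_iff, mk_mem_edgesIn, Finset.mem_erase]
      have := @hXP u
      have := @hXP v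
      tauto
  have h3 := Set.ncard_union_add_ncard_inter (edgesIn G (P.erase x)) (edgesIn G X)
    (finite_edgesIn _ _) (finite_edgesIn _ _)
  rw [← h1, ← h2, ← edgeCount_eq, ← edgeCount_eq, ← edgeCount_eq, ← edgeCount_eq] at h3
  have h3' : (edgeCount G P : ℝ) + edgeCount G (X.erase x)
      = edgeCount G (P.erase x) + edgeCount G X := by exact_mod_cast h3
  have h4 : ((P.erase x).card : ℝ) + 1 = P.card := by
    exact_mod_cast Finset.card_erase_add_one (hXP hx)
  have h5 : ((X.erase x).card : ℝ) + 1 = X.card := by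
    exact_mod_cast Finset.card_erase_add_one hx
  simp only [predim]
  rw [← h4, ← h5]
  linear_combination (-α) * h3'

/-- Erasing `x` matches the intermediate sets on the two sides and shifts all their predimensions by
one constant. -/
theorem graphStrong_erase_iff {V : Type} [DecidableEq V] {α : ℝ} {G : SimpleGraph V}
    {X Y P Q : Finset V} {x : V} (hno : ∀ v ∈ Y, G.Adj x v → v ∈ X) (hx : x ∈ X)
    (hXP : X ⊆ P) (hPQ : P ⊆ Q) (hQY : Q ⊆ Y) :
    GraphStrong α G (P.erase x) (Q.erase x) ↔ GraphStrong α G P Q := by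
  have hP := predim_sub_predim_erase α hno hx hXP (hPQ.trans hQY)
  have hxP := hXP hx
  constructor
  · rintro ⟨-, h⟩
    refine ⟨hPQ, fun B hPB hBQ => ?_⟩
    have hB := predim_sub_predim_erase α hno hx (hXP.trans hPB.1) (hBQ.trans hQY)
    have := h (B.erase x) (by
      refine ⟨Finset.erase_subset_erase _ hPB.1, fun hh => hPB.2 fun v hv => ?_⟩
      by_cases hvx : v = x
      · exact hvx ▸ hxP
      · exact Finset.mem_of_mem_erase (hh (Finset.mem_erase.2 ⟨hvx, hv⟩)))
      (Finset.erase_subset_erase _ hBQ)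
    linarith
  · rintro ⟨-, h⟩
    refine ⟨Finset.erase_subset_erase _ hPQ, fun B hPB hBQ => ?_⟩
    have hxB : x ∉ B := fun hh => Finset.notMem_erase x Q (hBQ hh)
    have hPB' : P ⊆ insert x B := by
      rw [← Finset.insert_erase hxP]
      exact Finset.insert_subset_insert _ hPB.1
    have hBQ' : insert x B ⊆ Q := by
      rw [← Finset.insert_erase (hPQ hxP)]
      exact Finset.insert_subset_insert _ hBQ
    have hB := predim_sub_predim_erase α hno hx (hXP.trans hPB') (hBQ'.trans hQY)
    rw [Finset.erase_insert hxB] at hB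
    have := h (insert x B) ⟨hPB', fun hh => hPB.2 fun v hv => Finset.mem_erase.2
      ⟨fun h' => hxB (h' ▸ hv), hh (Finset.mem_insert_of_mem hv)⟩⟩ hBQ'
    linarith

theorem IsZeroExt.erase {V : Type} [DecidableEq V] {α : ℝ} {G : SimpleGraph V}
    {X Y : Finset V} {x : V} (h : IsZeroExt α G X Y)
    (hno : ∀ v ∈ Y, G.Adj x v → v ∈ X) (hx : x ∈ X) :
    X ⊆ Y ∧ IsZeroExt α G (X.erase x) (Y.erase x) := by
  suffices H : ∀ Q, Relation.ReflTransGen (fun P Q => IsMinimalPair (GraphStrong α G) P Q ∧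
      predim α G Q - predim α G P = 0) X Q → Q ⊆ Y → X ⊆ Q ∧
      Relation.ReflTransGen (fun P Q => IsMinimalPair (GraphStrong α G) P Q ∧
        predim α G Q - predim α G P = 0) (X.erase x) (Q.erase x) by
    obtain ⟨h1, h2⟩ := H Y h.2 subset_rfl
    exact ⟨h1, h.1.mono (Finset.erase_subset _ _), h2⟩
  intro Q hQ
  induction hQ with
  | refl => exact fun _ => ⟨subset_rfl, .refl⟩
  | @tail P Q _ hPQ ih =>
    intro hQY
    obtain ⟨⟨hsub, hns, hmin⟩, hd⟩ := hPQ
    obtain ⟨hXP, hc⟩ := ih (hsub.trans hQY)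
    refine ⟨hXP.trans hsub, hc.tail ⟨⟨Finset.erase_subset_erase _ hsub, ?_, ?_⟩, ?_⟩⟩
    · rwa [graphStrong_erase_iff hno hx hXP hsub hQY]
    · intro B hPB hBQ
      have hxB : x ∉ B := fun hh => Finset.notMem_erase x Q (hBQ.1 hh)
      have hxP := hXP hx
      have hPB' : P ⊆ insert x B := by
        rw [← Finset.insert_erase hxP]
        exact Finset.insert_subset_insert _ hPB
      have hBQ' : insert x B ⊆ Q := by
        rw [← Finset.insert_erase (hsub hxP)]
        exact Finset.insert_subset_insert _ hBQ.1
      have := hmin (insert x B) hPB' ⟨hBQ', fun hh => hBQ.2 fun v hv => by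
        obtain ⟨hvx, hv⟩ := Finset.mem_erase.1 hv
        exact Finset.mem_of_mem_insert_of_ne (hh hv) hvx⟩
      rw [← graphStrong_erase_iff hno hx hXP hPB' (hBQ'.trans hQY),
        Finset.erase_insert hxB] at this
      exact this
    · have h1 := predim_sub_predim_erase α hno hx hXP (hsub.trans hQY)
      have h2 := predim_sub_predim_erase α hno hx (hXP.trans hsub) hQY
      linarith

/-- If some `x` had no new neighbour, it could be erased from the whole chain, leaving a
`0`-extension of a smaller set by the same new vertices. -/
theorem IsProperZeroExt.exists_adj {V : Type} {α : ℝ} {G : SimpleGraph V}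
    {X Y : Finset V} {x : V} (h : IsProperZeroExt α G X Y) (hx : x ∈ X) :
    ∃ y ∈ Y, y ∉ X ∧ G.Adj x y := by
  classical
  by_contra! hno
  obtain ⟨hXY, h'⟩ := h.1.erase (x := x) (fun v hv ha => by
    by_contra hvX
    exact hno v hv hvX ha) hx
  apply h.2.1 _ (Finset.erase_ssubset hx)
  convert h' using 1
  ext v
  have := @hXY v
  by_cases hvx : v = x
  · subst hvx; simp [hx]
  · simp [hvx]; tauto

/-! ### The gadget structure coding a finite graph -/

/-! ### Combinatorics of one gadget: blocks of lengths `p` and `q` in `[0, pq)`. -/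

section Arithmetic

variable {p q : ℕ}

/-- The first node touched by the `j`-th edge of a gadget. -/
def lowNode [NeZero p] (j : Fin q) : Fin p :=
  ⟨j * p / q, Nat.div_lt_of_lt_mul (Nat.mul_lt_mul_of_pos_right j.2 (NeZero.pos p))⟩

/-- The last node touched by the `j`-th edge of a gadget. -/
def highNode [NeZero p] (j : Fin q) : Fin p :=
  ⟨(j * p + p - 1) / q, Nat.div_lt_of_lt_mul (by
    have h1 : (j + 1) * p ≤ q * p := Nat.mul_le_mul_right p j.2
    have h2 := NeZero.pos p
    rw [add_mul, one_mul] at h1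
    omega)⟩

variable [NeZero p]

theorem lowNode_lt_highNode {j : Fin q} (h : lowNode (p := p) j ≠ highNode j) :
    (lowNode (p := p) j : ℕ) < highNode (p := p) j := by
  have : (lowNode (p := p) j : ℕ) ≤ highNode (p := p) j :=
    Nat.div_le_div_right (by have := NeZero.pos p; omega)
  exact lt_of_le_of_ne this fun hh => h (Fin.ext hh)

/-- An edge between two nodes straddles the boundary point `highNode j * q`, which lies in only one
block of length `p`. -/
theorem highNode_injOn (hpq : p < q) {j k : Fin q} (hj : lowNode (p := p) j ≠ highNode j)
    (hk : lowNode (p := p) k ≠ highNode k) (h : highNode (p := p) j = highNode k) : j = k := by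
  have key : ∀ j : Fin q, lowNode (p := p) j ≠ highNode j →
      (j : ℕ) = (highNode (p := p) j : ℕ) * q / p := by
    intro j hj
    have hlt := lowNode_lt_highNode hj
    have hp := NeZero.pos p
    have h1 : (highNode (p := p) j : ℕ) * q ≤ j * p + p - 1 := Nat.div_mul_le_self _ _
    have h2 : (j : ℕ) * p < (highNode (p := p) j : ℕ) * q :=
      (Nat.div_lt_iff_lt_mul (by omega)).1 hlt
    refine (Nat.div_eq_of_lt_le ?_ ?_).symm
    · exact h2.le
    · rw [add_mul, one_mul]; omega
  ext
  rw [key j hj, key k hk, h]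

/-- Edge `j` owns the block `[jp, (j+1)p)` and node `i` the block `[iq, (i+1)q)`. As `p < q`, an
edge block meets at most two node blocks. -/
theorem div_eq_lowNode_or_highNode (hpq : p < q) (t : ℕ) (j : Fin q) (ht : t / p = j) :
    t / q = (lowNode (p := p) j : ℕ) ∨ t / q = (highNode (p := p) j : ℕ) := by
  have hp := NeZero.pos p
  have h1 : (j : ℕ) * p ≤ t := by rw [← ht]; exact Nat.div_mul_le_self _ _
  have h2 : t < j * p + p := by rw [← ht]; exact Nat.lt_div_mul_add hp
  have h3 : (lowNode (p := p) j : ℕ) ≤ t / q := Nat.div_le_div_right h1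
  have h4 : t / q ≤ (highNode (p := p) j : ℕ) := Nat.div_le_div_right (by omega)
  have h5 : (highNode (p := p) j : ℕ) ≤ (lowNode (p := p) j : ℕ) + 1 := by
    have : (lowNode (p := p) j : ℕ) + 1 = (j * p + q) / q := by
      rw [Nat.add_div_right _ (by omega)]; rfl
    rw [this]
    exact Nat.div_le_div_right (by omega)
  omega

theorem card_filter_div_mem {m n : ℕ} (I : Finset (Fin m)) :
    ((Finset.range (m * n)).filter fun t => ∃ i ∈ I, t / n = (i : ℕ)).card = I.card * n := by
  rcases Nat.eq_zero_or_pos n with rfl | hn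
  · simp
  have : I.card * n = (I ×ˢ Finset.range n).card := by simp
  rw [this]
  symm
  refine Finset.card_bij (fun x _ => (x.1 : ℕ) * n + x.2) ?_ ?_ ?_
  · rintro ⟨i, s⟩ h
    simp only [Finset.mem_product, Finset.mem_range] at h
    have h1 : ((i : ℕ) + 1) * n ≤ m * n := Nat.mul_le_mul_right n i.2
    rw [add_mul, one_mul] at h1
    simp only [Finset.mem_filter, Finset.mem_range]
    refine ⟨by omega, i, h.1, ?_⟩
    rw [mul_comm, Nat.mul_add_div hn, Nat.div_eq_of_lt h.2, add_zero]
  · rintro ⟨i, s⟩ h ⟨i', s'⟩ h' hh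
    simp only [Finset.mem_product, Finset.mem_range] at h h' hh
    have e1 : ((i : ℕ) * n + s) / n = i := by
      rw [mul_comm, Nat.mul_add_div hn, Nat.div_eq_of_lt h.2, add_zero]
    have e2 : ((i' : ℕ) * n + s') / n = i' := by
      rw [mul_comm, Nat.mul_add_div hn, Nat.div_eq_of_lt h'.2, add_zero]
    have hi : (i : ℕ) = i' := by rw [← e1, ← e2, hh]
    have hs : s = s' := by rw [hi] at hh; omega
    rw [Fin.ext hi, hs]
  · intro t ht
    simp only [Finset.mem_filter, Finset.mem_range] at ht
    obtain ⟨-, i, hi, hti⟩ := ht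
    refine ⟨(i, t % n), ?_, ?_⟩
    · simp [hi, Nat.mod_lt _ hn]
    · simp only
      rw [← hti, Nat.div_add_mod']

/-- The blocks of the edges in `J` are covered by the blocks of the nodes in `I`; compare lengths.
-/
theorem mul_card_le_of_ends_mem (hpq : p < q) (J : Finset (Fin q)) (I : Finset (Fin p))
    (h : ∀ j ∈ J, lowNode j ∈ I ∧ highNode j ∈ I) : p * J.card ≤ q * I.card := by
  rw [mul_comm p, mul_comm q, ← card_filter_div_mem, ← card_filter_div_mem, mul_comm q p]
  refine Finset.card_le_card fun t ht => ?_
  simp only [Finset.mem_filter] at ht ⊢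
  obtain ⟨ht, j, hj, htj⟩ := ht
  refine ⟨ht, ?_⟩
  rcases div_eq_lowNode_or_highNode hpq t j htj with h' | h'
  · exact ⟨_, (h j hj).1, h'⟩
  · exact ⟨_, (h j hj).2, h'⟩

/-- Dually, the blocks of the nodes in `I` are covered by the blocks of the edges touching them. -/
theorem mul_card_le_of_touching (hpq : p < q) (J : Finset (Fin q)) (I : Finset (Fin p))
    (h : ∀ j, lowNode j ∈ I ∨ highNode j ∈ I → j ∈ J) : q * I.card ≤ p * J.card := by
  rw [mul_comm p, mul_comm q, ← card_filter_div_mem, ← card_filter_div_mem, mul_comm q p]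
  refine Finset.card_le_card fun t ht => ?_
  simp only [Finset.mem_filter, Finset.mem_range] at ht ⊢
  obtain ⟨ht, i, hi, hti⟩ := ht
  have hj : t / p < q := Nat.div_lt_of_lt_mul ht
  refine ⟨ht, ⟨t / p, hj⟩, h _ ?_, rfl⟩
  rcases div_eq_lowNode_or_highNode hpq t ⟨t / p, hj⟩ rfl with h' | h'
  · exact Or.inl (by rwa [← Fin.ext (hti.symm.trans h')])
  · exact Or.inr (by rwa [← Fin.ext (hti.symm.trans h')])

theorem lowNode_zero [NeZero q] : lowNode (p := p) (0 : Fin q) = 0 := by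
  ext; simp [lowNode]

theorem highNode_zero [NeZero q] (hpq : p < q) : highNode (p := p) (0 : Fin q) = 0 := by
  ext
  simp only [highNode, Fin.val_zero]
  exact Nat.div_eq_of_lt (by omega)

end Arithmetic

/-- The vertices of the gadget structure coding the graph `R`: each vertex `c` of `R` has a base of
`q` vertices, and each pair `(c, d)` a path of `p` nodes attached to the base of `c`. -/
inductive GadgetVertex {C : Type} (R : SimpleGraph C) (p q : ℕ) : Type
  | base (c : C) (j : Fin q)
  | node (c d : C) (i : Fin p)

namespace GadgetVertex

variable {C : Type} {R : SimpleGraph C} {p q : ℕ}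

/-- The vertex of `R` to whose component a vertex belongs. -/
def comp : GadgetVertex R p q → C
  | base c _ => c
  | node c _ _ => c

/-- The equivalence relation interpreting `S`. -/
def Linked : GadgetVertex R p q → GadgetVertex R p q → Prop
  | base c _, base c' _ => c = c'
  | node c d i, node c' d' i' =>
    -- This is the only place where the edges of `R` enter; the graph reduct does not depend on
    -- them.
    (c = c' ∧ d = d' ∧ i = i') ∨ (R.Adj c d ∧ c' = d ∧ d' = c ∧ i = i')
  | _, _ => False

instance [Finite C] : Finite (GadgetVertex R p q) := by
  refine Finite.of_surjective
    (fun x : (C × Fin q) ⊕ (C × C × Fin p) => Sum.elim (fun y => (base y.1 y.2 : GadgetVertex R p q))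
      (fun y => node y.1 y.2.1 y.2.2) x) ?_
  rintro (⟨c, j⟩ | ⟨c, d, i⟩)
  · exact ⟨Sum.inl (c, j), rfl⟩
  · exact ⟨Sum.inr (c, d, i), rfl⟩

noncomputable instance [Finite C] : Fintype (GadgetVertex R p q) := Fintype.ofFinite _

theorem linked_refl (u : GadgetVertex R p q) : Linked u u := by
  cases u <;> simp [Linked]

theorem Linked.symm {u v : GadgetVertex R p q} (h : Linked u v) : Linked v u := by
  cases u <;> cases v <;> simp only [Linked] at h ⊢
  · exact h.symm
  · rcases h with ⟨rfl, rfl, rfl⟩ | ⟨h, rfl, rfl, rfl⟩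
    · simp
    · exact Or.inr ⟨h.symm, rfl, rfl, rfl⟩

theorem Linked.trans {u v w : GadgetVertex R p q} (h : Linked u v) (h' : Linked v w) :
    Linked u w := by
  cases u <;> cases v <;> cases w <;> simp only [Linked] at h h' ⊢
  · exact Eq.trans h h'
  · rcases h with ⟨rfl, rfl, rfl⟩ | ⟨h, rfl, rfl, rfl⟩
    · exact h'
    · rcases h' with ⟨rfl, rfl, rfl⟩ | ⟨h', rfl, rfl, rfl⟩
      · exact Or.inr ⟨h, rfl, rfl, rfl⟩
      · simp

open Classical in
theorem card_filter_linked_le [Finite C]  (hq : 2 ≤ q) (u : GadgetVertex R p q) (A : Finset (GadgetVertex R p q)) :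
    (A.filter (Linked u)).card ≤ q := by
  classical
  cases u with
  | base c j =>
    calc _ ≤ (Finset.univ.image fun k : Fin q => (base c k : GadgetVertex R p q)).card := by
          refine Finset.card_le_card fun v hv => ?_
          have hv := (Finset.mem_filter.1 hv).2
          cases v with
          | base c' k => simp only [Linked] at hv; simp [hv]
          | node => simp only [Linked] at hv
      _ ≤ q := Finset.card_image_le.trans (by simp)
  | node c d i =>
    calc _ ≤ ({node c d i, node d c i} : Finset (GadgetVertex R p q)).card := by
          refine Finset.card_le_card fun v hv => ?_
          have hv := (Finset.mem_filter.1 hv).2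
          cases v with
          | base => simp only [Linked] at hv
          | node c' d' i' =>
            simp only [Linked] at hv
            rcases hv with ⟨rfl, rfl, rfl⟩ | ⟨h, rfl, rfl, rfl⟩ <;> simp
      _ ≤ q := Finset.card_le_two.trans hq

variable [NeZero p]

/-- The first end of the `j`-th edge of the gadget `(c, d)`. -/
def tail (R : SimpleGraph C) (c d : C) (j : Fin q) : GadgetVertex R p q := node c d (lowNode j)

/-- The second end of the `j`-th edge of the gadget `(c, d)`. -/
def head (R : SimpleGraph C) (c d : C) (j : Fin q) : GadgetVertex R p q :=
  if lowNode (p := p) j = highNode j then base c j else node c d (highNode j)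

/-- Adjacency, oriented from tail to head. -/
def Arc (u v : GadgetVertex R p q) : Prop := ∃ c d j, u = tail R c d j ∧ v = head R c d j

instance : LStar.Structure (GadgetVertex R p q) where
  funMap f := Empty.elim f
  RelMap r v := match r, v with
    | .adj, v => Arc (v 0) (v 1) ∨ Arc (v 1) (v 0)
    | .cls, v => Linked (v 0) (v 1)

theorem adjRel_iff {u v : GadgetVertex R p q} : adjRel u v ↔ Arc u v ∨ Arc v u := Iff.rfl

theorem clsRel_iff {u v : GadgetVertex R p q} : clsRel u v ↔ Linked u v := Iff.rfl

theorem tail_ne_head (c d : C) (j : Fin q) :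
    (tail R c d j : GadgetVertex R p q) ≠ head R c d j := by
  rw [tail, head]
  split_ifs with h
  · simp
  · simp [h]

theorem comp_tail (c d : C) (j : Fin q) : (tail R c d j : GadgetVertex R p q).comp = c := rfl

theorem comp_head (c d : C) (j : Fin q) : (head R c d j : GadgetVertex R p q).comp = c := by
  rw [head]; split_ifs <;> rfl

theorem Arc.ne {u v : GadgetVertex R p q} (h : Arc u v) : u ≠ v := by
  obtain ⟨c, d, j, rfl, rfl⟩ := h
  exact tail_ne_head c d j

theorem Arc.comp_eq {u v : GadgetVertex R p q} (h : Arc u v) : u.comp = v.comp := by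
  obtain ⟨c, d, j, rfl, rfl⟩ := h
  rw [comp_tail, comp_head]

theorem graphOf_adj {u v : GadgetVertex R p q} :
    (graphOf (GadgetVertex R p q)).Adj u v ↔ Arc u v ∨ Arc v u := by
  rw [graphOf, SimpleGraph.fromRel_adj, adjRel_iff, adjRel_iff]
  constructor
  · tauto
  · intro h
    exact ⟨h.elim Arc.ne fun h' => h'.ne.symm, Or.inl h⟩

theorem exists_edge {u v : GadgetVertex R p q} (h : (graphOf (GadgetVertex R p q)).Adj u v) :
    ∃ c d j, s((tail R c d j : GadgetVertex R p q), head R c d j) = s(u, v) := by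
  rcases graphOf_adj.1 h with ⟨c, d, j, rfl, rfl⟩ | ⟨c, d, j, rfl, rfl⟩
  · exact ⟨c, d, j, rfl⟩
  · exact ⟨c, d, j, Sym2.eq_swap⟩

theorem comp_eq_of_adj {u v : GadgetVertex R p q} (h : (graphOf (GadgetVertex R p q)).Adj u v) :
    u.comp = v.comp := by
  rcases graphOf_adj.1 h with h | h
  · exact h.comp_eq
  · exact h.comp_eq.symm

theorem exists_node_of_adj_base {c : C} {j : Fin q} {v : GadgetVertex R p q}
    (h : adjRel v (base c j)) : ∃ d i, v = node c d i := by
  rcases adjRel_iff.1 h with ⟨c', d, k, rfl, hh⟩ | ⟨c', d, k, hh, rfl⟩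
  · rw [head] at hh
    split_ifs at hh
    cases hh
    exact ⟨d, _, rfl⟩
  · cases hh

/-- The edges of the structure inside `W`. -/
theorem exists_index_of_mem_edgesIn {W : Finset (GadgetVertex R p q)}
    {e : Sym2 (GadgetVertex R p q)} (he : e ∈ edgesIn (graphOf (GadgetVertex R p q)) W) :
    ∃ x : C × C × Fin q, (tail R x.1 x.2.1 x.2.2 ∈ W ∧ head R x.1 x.2.1 x.2.2 ∈ W) ∧
      s(tail R x.1 x.2.1 x.2.2, head R x.1 x.2.1 x.2.2) = e := by
  induction e with
  | h u v =>
    obtain ⟨h, hu, hv⟩ := mk_mem_edgesIn.1 he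
    obtain ⟨c, d, j, hh⟩ := exists_edge h
    refine ⟨(c, d, j), ?_, hh⟩
    rcases Sym2.eq_iff.1 hh with ⟨h1, h2⟩ | ⟨h1, h2⟩
    · exact ⟨h1 ▸ hu, h2 ▸ hv⟩
    · exact ⟨h1 ▸ hv, h2 ▸ hu⟩

/-! ### Sparsity of the gadget structure and the bound on copies. -/

/-- Charge each edge to its head. A node is the head of at most one edge, and a node of least index
in `W` is the head of none inside `W`, since tails have smaller index. -/
theorem edgeCount_lt_card (hpq : p < q) {W : Finset (GadgetVertex R p q)} (hW : W.Nonempty)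
    (hb : ∀ c j, base c j ∉ W) :
    edgeCount (graphOf (GadgetVertex R p q)) W + 1 ≤ W.card := by
  classical
  let idx : GadgetVertex R p q → ℕ := fun v => match v with
    | base _ _ => 0
    | node _ _ i => i
  obtain ⟨w, hw, hmin⟩ := Finset.exists_min_image W idx hW
  rw [← Finset.card_erase_add_one hw]
  refine Nat.add_le_add_right ?_ 1
  have hhead : ∀ (c d : C) (j : Fin q), (head R c d j : GadgetVertex R p q) ∈ W →
      lowNode (p := p) j ≠ highNode j ∧
        (head R c d j : GadgetVertex R p q) = node c d (highNode j) := by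
    intro c d j h
    rw [head] at h ⊢
    split_ifs at h ⊢ with h'
    · exact absurd h (hb _ _)
    · exact ⟨h', rfl⟩
  have hch : ∀ v : GadgetVertex R p q, ∃ e : Sym2 (GadgetVertex R p q),
      ∀ (c d : C) (j : Fin q), (head R c d j : GadgetVertex R p q) ∈ W → head R c d j = v →
        e = s(tail R c d j, head R c d j) := by
    intro v
    by_cases hv : ∃ (c d : C) (j : Fin q), (head R c d j : GadgetVertex R p q) ∈ W ∧ head R c d j = v
    · obtain ⟨c, d, j, h1, h2⟩ := hv
      refine ⟨s(tail R c d j, head R c d j), fun c' d' j' h1' h2' => ?_⟩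
      rw [h2, ← h2']
      rw [← h2', (hhead _ _ _ h1).2, (hhead _ _ _ h1').2] at h2
      injection h2 with e1 e2 e3
      subst e1 e2
      rw [highNode_injOn hpq (hhead _ _ _ h1).1 (hhead _ _ _ h1').1 e3]
    -- Default value for a vertex that is not a head.
    · exact ⟨s(v, v), fun c d j h1 h2 => absurd ⟨c, d, j, h1, h2⟩ hv⟩
  choose f hf using hch
  refine edgeCount_le_card _ _ _ f fun e he => ?_
  obtain ⟨⟨c, d, j⟩, ⟨h1, h2⟩, h⟩ := exists_index_of_mem_edgesIn he
  refine ⟨head R c d j, Finset.mem_erase.2 ⟨fun hh => ?_, h2⟩, (hf _ c d j h2 rfl).trans h⟩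
  have := hmin _ h1
  rw [← hh, (hhead _ _ _ h2).2] at this
  have h3 := lowNode_lt_highNode (hhead _ _ _ h2).1
  exact absurd h3 (not_lt.2 this)

open Classical in
-- Sum the block inequality over all gadgets. An edge to a base has both `lowNode` and `highNode` at
-- its tail, so it too has both end nodes in `W`.
theorem mul_edgeCount_le [Finite C] (hpq : p < q) (W : Finset (GadgetVertex R p q)) :
    p * edgeCount (graphOf (GadgetVertex R p q)) W
      ≤ q * (W.filter fun v => ∃ c d i, v = node c d i).card := by
  set Wn := W.filter fun v => ∃ c d i, v = node c d i with hWn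
  have := Fintype.ofFinite C
  let J : C × C → Finset (Fin q) := fun x =>
    Finset.univ.filter fun j => tail R x.1 x.2 j ∈ W ∧ head R x.1 x.2 j ∈ W
  let I : C × C → Finset (Fin p) := fun x => Finset.univ.filter fun i => node x.1 x.2 i ∈ W
  have h1 : edgeCount (graphOf (GadgetVertex R p q)) W ≤ (Finset.univ.sigma J).card :=
    edgeCount_le_card _ _ _ (fun x => s(tail R x.1.1 x.1.2 x.2, head R x.1.1 x.1.2 x.2))
      fun e he => by
        obtain ⟨⟨c, d, j⟩, h, h'⟩ := exists_index_of_mem_edgesIn he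
        exact ⟨⟨(c, d), j⟩, by simpa [J] using h, h'⟩
  have h2 : (Finset.univ.sigma I).card ≤ Wn.card := by
    refine Finset.card_le_card_of_injOn (fun x => node x.1.1 x.1.2 x.2) ?_ ?_
    · rintro ⟨⟨c, d⟩, i⟩ h
      simpa [I, hWn] using h
    · rintro ⟨⟨c, d⟩, i⟩ - ⟨⟨c', d'⟩, i'⟩ - h
      simp only [node.injEq] at h
      obtain ⟨rfl, rfl, rfl⟩ := h
      rfl
  refine (Nat.mul_le_mul_left p h1).trans (le_trans ?_ (Nat.mul_le_mul_left q h2))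
  rw [Finset.card_sigma, Finset.card_sigma, Finset.mul_sum, Finset.mul_sum]
  refine Finset.sum_le_sum fun x _ => mul_card_le_of_ends_mem hpq _ _ fun j hj => ?_
  simp only [J, I, Finset.mem_filter, Finset.mem_univ, true_and] at hj ⊢
  refine ⟨hj.1, ?_⟩
  have h := hj.2
  rw [head] at h
  split_ifs at h with h'
  · rw [← h']; exact hj.1
  · exact h

/-- By `mul_edgeCount_le` the nodes pay for all edges, so one base point already gives `δ ≥ 1`.
Without base points, `W` has fewer edges than vertices. -/
theorem one_le_predim [Finite C] (hpq : p < q) {W : Finset (GadgetVertex R p q)}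
    (hW : W.Nonempty) :
    1 ≤ predim ((p : ℝ) / q) (graphOf (GadgetVertex R p q)) W := by
  classical
  have hq : (0 : ℝ) < q := by exact_mod_cast (Nat.zero_le p).trans_lt hpq
  rw [predim]
  by_cases hb : ∃ c j, base c j ∈ W
  · obtain ⟨c, j, hcj⟩ := hb
    have h1 := mul_edgeCount_le hpq W
    have h2 : (W.filter fun v => ∃ c d i, v = node c d i).card + 1 ≤ W.card :=
      Finset.card_lt_card (Finset.filter_ssubset.2 ⟨_, hcj, by simp⟩)
    have h3 : q * ((W.filter fun v => ∃ c d i, v = node c d i).card + 1) ≤ q * W.card :=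
      Nat.mul_le_mul_left q h2
    have h4 : p * edgeCount (graphOf (GadgetVertex R p q)) W + q ≤ q * W.card := by
      rw [mul_add, mul_one] at h3; omega
    have h5 : (p : ℝ) * edgeCount (graphOf (GadgetVertex R p q)) W + q ≤ q * W.card := by
      exact_mod_cast h4
    rw [div_mul_eq_mul_div, le_sub_iff_add_le, ← le_sub_iff_add_le', div_le_iff₀ hq]
    linarith
  · push Not at hb
    have h1 := edgeCount_lt_card hpq hW hb
    have h2 : (edgeCount (graphOf (GadgetVertex R p q)) W : ℝ) + 1 ≤ W.card := by
      exact_mod_cast h1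
    have h3 : (p : ℝ) / q ≤ 1 := by rw [div_le_one hq]; exact_mod_cast hpq.le
    have h4 : (0 : ℝ) ≤ edgeCount (graphOf (GadgetVertex R p q)) W := Nat.cast_nonneg _
    nlinarith

theorem inKPlus [Finite C] (hpq : p < q) (W : Finset (GadgetVertex R p q)) :
    InKPlus ((p : ℝ) / q) (graphOf (GadgetVertex R p q)) W :=
  fun _ _ hne => one_pos.trans_le (one_le_predim hpq hne)

/-- A node has at most `q` neighbours. -/
theorem card_le_of_adj_node {ι : Type} (F : Finset ι) (c d : C) (i : Fin p)
    (f : ι → GadgetVertex R p q) (hf : Set.InjOn f F)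
    (h : ∀ y ∈ F, (graphOf (GadgetVertex R p q)).Adj (node c d i) (f y)) : F.card ≤ q := by
  have key : ∀ y ∈ F, ∃ j : Fin q,
      s((tail R c d j : GadgetVertex R p q), head R c d j) = s(node c d i, f y) := by
    intro y hy
    obtain ⟨c', d', j, hh⟩ := exists_edge (h y hy)
    -- Edges at a node belong to its own gadget, so the index `j` alone determines the neighbour.
    have : c' = c ∧ d' = d := by
      rcases Sym2.eq_iff.1 hh with ⟨h1, h2⟩ | ⟨h1, h2⟩
      · rw [tail] at h1; injection h1 with e1 e2; exact ⟨e1, e2⟩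
      · rw [head] at h2
        split_ifs at h2
        injection h2 with e1 e2
        exact ⟨e1, e2⟩
    obtain ⟨rfl, rfl⟩ := this
    exact ⟨j, hh⟩
  rcases F.eq_empty_or_nonempty with rfl | ⟨y₀, hy₀⟩
  · simp
  have : Nonempty (Fin q) := ⟨(key y₀ hy₀).choose⟩
  choose! j hj using key
  have := Finset.card_le_card_of_injOn (t := Finset.univ) j (fun _ _ => Finset.mem_coe.2 (Finset.mem_univ _)) (by
    intro y hy y' hy' hyy
    apply hf hy hy'
    have := (hj y hy).symm.trans (hyy ▸ hj y' hy')
    exact Sym2.congr_right.1 this)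
  simpa using this

/-- Any node in `X` has a new neighbour in every copy, and disjointness over `X` makes these
neighbours distinct, so the degree bound applies. -/
theorem card_copies_le {α : ℝ} {X Y : Finset (GadgetVertex R p q)} (hX : ¬ IsHomogeneous X)
    (hXY : IsProperZeroExt α (graphOf (GadgetVertex R p q)) X Y)
    (F : Finset (Finset (GadgetVertex R p q)))
    (hF : ∀ Y' ∈ F, IsCopyOver (graphOf (GadgetVertex R p q)) X Y Y')
    (hd : ∀ Y' ∈ F, ∀ Y'' ∈ F, Y' ≠ Y'' → ∀ v ∈ Y', v ∈ Y'' → v ∈ X) : F.card ≤ q := by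
  classical
  -- The new vertices do not split freely, and edges stay within one component; hence all new
  -- vertices share a component.
  have hcomp : ∀ y ∈ Y, y ∉ X → ∀ y' ∈ Y, y' ∉ X → y.comp = y'.comp := by
    intro y hy hyX y' hy' hyX'
    by_contra hne
    refine hXY.2.2 ⟨(Y \ X).filter fun v => v.comp = y.comp,
      (Y \ X).filter fun v => ¬ v.comp = y.comp, ⟨y, by simp [hy, hyX]⟩,
      ⟨y', by simpa [hy', hyX'] using fun h => hne h.symm⟩,
      Finset.disjoint_filter_filter_not _ _ _, ?_, ?_⟩
    · convert Finset.filter_union_filter_not_eq _ _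
    · intro u hu v hv h
      rw [Finset.mem_filter] at hu hv
      exact hv.2 ((comp_eq_of_adj h).symm.trans hu.2)
  have hcompX : ∀ x ∈ X, ∀ x' ∈ X, x.comp = x'.comp := by
    intro x hx x' hx'
    obtain ⟨y, hy, hyX, ha⟩ := hXY.exists_adj hx
    obtain ⟨y', hy', hyX', ha'⟩ := hXY.exists_adj hx'
    rw [comp_eq_of_adj ha, comp_eq_of_adj ha', hcomp y hy hyX y' hy' hyX']
  -- Base points of a single component form one `S`-class, so non-homogeneity forces a node into
  -- `X`.
  obtain ⟨c, d, i, hx⟩ : ∃ c d i, node c d i ∈ X := by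
    by_contra! hno
    apply hX
    intro x hx x' hx'
    cases x with
    | node => exact absurd hx (hno _ _ _)
    | base c j =>
      cases x' with
      | node => exact absurd hx' (hno _ _ _)
      | base c' j' => exact clsRel_iff.2 (hcompX _ hx _ hx')
  have key : ∀ Y' ∈ F, ∃ y ∈ Y', y ∉ X ∧ (graphOf (GadgetVertex R p q)).Adj (node c d i) y := by
    intro Y' hY'
    obtain ⟨hs, hs', f, hf⟩ := hF Y' hY'
    obtain ⟨y, hy, hyX, ha⟩ := hXY.exists_adj hx
    have hxY : node c d i ∈ (Y : Set (GadgetVertex R p q)) := hs hx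
    refine ⟨f ⟨y, hy⟩, (f ⟨y, hy⟩).2, fun hh => hyX ?_, ?_⟩
    · have h1 := hf _ (hs hh) hh
      have h2 := f.injective (Subtype.ext h1)
      have h3 : ((f ⟨y, hy⟩ : (Y' : Set (GadgetVertex R p q))) : GadgetVertex R p q) = y :=
        congrArg Subtype.val h2
      rwa [h3] at hh
    · have h1 := hf _ hxY hx
      have h2 : ((graphOf (GadgetVertex R p q)).induce (Y' : Set _)).Adj (f ⟨_, hxY⟩) (f ⟨y, hy⟩) :=
        f.map_rel_iff.2 ha
      rw [← h1]
      exact h2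
  have : Nonempty (GadgetVertex R p q) := ⟨node c d i⟩
  choose! y hy hyX ha using key
  refine card_le_of_adj_node F c d i y ?_ ha
  intro Y' hY' Y'' hY'' h
  by_contra hne
  exact hyX Y' hY' (hd Y' hY' Y'' hY'' hne _ (hy Y' hY') (h ▸ hy Y'' hY''))

theorem isAdmissible [Finite C] (hpq : p < q) (hco : p.Coprime q) {N : ℕ} (hN : q < N)
    {μ : GraphPairFun} (hμ : IsMuFunction ((p : ℝ) / q) μ) (A : Finset (GadgetVertex R p q)) :
    IsAdmissible ((p : ℝ) / q) N μ A where
  adj_irrefl x _ h := (adjRel_iff.1 h).elim (fun h => h.ne rfl) (fun h => h.ne rfl)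
  adj_symm x _ y _ h := (adjRel_iff.1 h).symm
  inKPlus := inKPlus hpq A
  cls_refl x _ := linked_refl x
  cls_symm x _ y _ h := Linked.symm h
  cls_trans x _ y _ z _ h h' := Linked.trans h h'
  cls_card x _ :=
    (card_filter_linked_le (by have := NeZero.pos p; omega) x A).trans_lt hN
  copies_le X _ hX Y _ hXY F hF hd := by
    have hne : X.Nonempty := by
      rw [Finset.nonempty_iff_ne_empty]
      rintro rfl
      exact hX fun x hx => absurd hx (Finset.notMem_empty x)
    have h1 : F.card ≤ q := card_copies_le hX hXY F (fun Y' h => (hF Y' h).2)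
      fun Y' h Y'' h' hYY v hv hv' => by
        rw [← hd Y' h Y'' h' hYY]
        convert Finset.mem_inter.2 ⟨hv, hv'⟩
    -- With `γ = 1/q` and `δ(X) ≥ 1` this yields `q ≤ 2qδ(X) ≤ ν(X)`.
    have h2 := le_nu hμ _ X (inKPlus hpq X)
    rw [granularity_eq (NeZero.pos p) hpq hco] at h2
    have h3 := one_le_predim hpq hne
    have h4 : (F.card : ℝ) ≤ q := by exact_mod_cast h1
    refine h4.trans (le_trans ?_ h2)
    rw [div_div_eq_mul_div, div_one]
    have : (0 : ℝ) ≤ q := Nat.cast_nonneg _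
    nlinarith

end GadgetVertex

/-! ### Strong embeddings into a generic structure -/

theorem isStrong_empty {α : ℝ} {V : Type} [LStar.Structure V] {B : Finset V}
    (h : InKPlus α (graphOf V) B) : IsStrong α ∅ B := by
  refine ⟨Finset.empty_subset _, fun X _ _ => Or.inr (Finset.disjoint_empty_right _),
    Finset.empty_subset _, fun W hW hWB => ?_⟩
  rw [predim_empty, sub_zero]
  exact h W hWB (Finset.empty_ssubset.1 hW)

instance : LStar.Structure Empty where
  funMap f := Empty.elim f
  RelMap _ _ := False

/-- The empty structure embeds into every structure. -/
def emptyEmbedding (M : Type) [LStar.Structure M] : Empty ↪[LStar] M where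
  toFun := Empty.elim
  inj' := fun x => x.elim
  map_fun' := fun f => Empty.elim f
  map_rel' := fun r x => match r, x with
    | .adj, x => (x 0).elim
    | .cls, x => (x 0).elim

theorem IsGeneric.exists_strong_embedding {α : ℝ} {N : ℕ} {μ : GraphPairFun} {M : Type}
    [LStar.Structure M] (hM : IsGeneric α N μ M) {B : Type} [Fintype B] [LStar.Structure B]
    (hB : IsAdmissible α N μ (Finset.univ : Finset B)) :
    ∃ g : B ↪[LStar] M, IsStrongIn α (Finset.univ.map g.toEmbedding) := by
  obtain ⟨g, hg, -⟩ := hM.extension Empty B (emptyEmbedding M) (emptyEmbedding B) hB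
    (fun A _ => isStrong_empty (hM.mem_class A).inKPlus) (isStrong_empty hB.inKPlus)
  exact ⟨g, hg⟩

/-! ### The coding formula -/

section Coding

variable {p q : ℕ} [NeZero p] {M : Type} [LStar.Structure M]

/-- The points `z` form a gadget attached to the base `x`. -/
def IsGadget (x : Fin q → M) (z : Fin p → M) : Prop :=
  (∀ i i', i ≠ i' → z i ≠ z i') ∧ (∀ i j, z i ≠ x j) ∧
    ∀ j : Fin q, adjRel (z (lowNode j))
      (if lowNode (p := p) j = highNode j then x j else z (highNode j))

/-- A gadget attached to a strong set lies inside it. -/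
theorem IsGadget.mem (hpq : p < q) {A : Finset M} (hA : IsStrongIn ((p : ℝ) / q) A)
    {x : Fin q → M} {z : Fin p → M} (hx : Function.Injective x) (hxA : ∀ j, x j ∈ A)
    (h : IsGadget x z) (i : Fin p) : z i ∈ A := by
  classical
  by_contra hi
  obtain ⟨hz, hzx, hadj⟩ := h
  have hz' : Function.Injective z := fun a b hab => by
    by_contra hne
    exact hz a b hne hab
  -- `I` collects the nodes outside `A`, and `J` the gadget edges touching them. Adjoining the `|I|`
  -- points adds at least `|J| ≥ (q/p)|I|` edges, so the predimension does not grow, contradicting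
  -- strongness. Further edges only help, so the gadget need not be induced.
  set I : Finset (Fin p) := Finset.univ.filter fun i => z i ∉ A with hI
  set J : Finset (Fin q) := Finset.univ.filter fun j => lowNode j ∈ I ∨ highNode j ∈ I with hJ
  have hzB : ∀ i, z i ∈ A ∪ I.image z := fun i => by
    by_cases h : z i ∈ A
    · exact Finset.mem_union_left _ h
    · exact Finset.mem_union_right _ (Finset.mem_image_of_mem _ (by simp [hI, h]))
  have hcard : (A ∪ I.image z).card = A.card + I.card := by
    rw [Finset.card_union_of_disjoint, Finset.card_image_of_injective _ hz']
    rw [Finset.disjoint_right]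
    intro v hv
    obtain ⟨i, hi, rfl⟩ := Finset.mem_image.1 hv
    exact (Finset.mem_filter.1 hi).2
  have hpos := (hA (A ∪ I.image z) Finset.subset_union_left).2.2.2 (A ∪ I.image z)
    ⟨Finset.subset_union_left, fun hh => hi (hh (hzB i))⟩ subset_rfl
  have hedge := card_le_edgeCount (graphOf M) A (A ∪ I.image z) Finset.subset_union_left J
    (fun j => s(z (lowNode j),
      if lowNode (p := p) j = highNode j then x j else z (highNode j))) (by
      intro j _ k _ hjk
      simp only [Sym2.eq_iff] at hjk
      by_cases h1 : lowNode (p := p) j = highNode j <;>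
        by_cases h2 : lowNode (p := p) k = highNode k
      · rw [if_pos h1, if_pos h2] at hjk
        rcases hjk with ⟨-, h⟩ | ⟨h, -⟩
        · exact hx h
        · exact absurd h (hzx _ _)
      · rw [if_pos h1, if_neg h2] at hjk
        rcases hjk with ⟨-, h⟩ | ⟨-, h⟩ <;> exact absurd h.symm (hzx _ _)
      · rw [if_neg h1, if_pos h2] at hjk
        rcases hjk with ⟨-, h⟩ | ⟨h, -⟩ <;> exact absurd h (hzx _ _)
      · rw [if_neg h1, if_neg h2] at hjk
        rcases hjk with ⟨-, h⟩ | ⟨h, h'⟩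
        · exact highNode_injOn hpq h1 h2 (hz' h)
        -- Two node edges cannot coincide with reversed ends, because each runs from a lower to a
        -- higher node.
        · have e1 := congrArg Fin.val (hz' h)
          have e2 := congrArg Fin.val (hz' h')
          have e3 := lowNode_lt_highNode h1
          have e4 := lowNode_lt_highNode h2
          omega) (by
      intro j hj
      refine ⟨mk_mem_edgesIn.2 ⟨?_, hzB _, ?_⟩, ?_⟩
      · rw [graphOf, SimpleGraph.fromRel_adj]
        refine ⟨?_, Or.inl (hadj j)⟩
        split_ifs with h
        · exact hzx _ _
        · exact hz _ _ h
      · split_ifs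
        · exact Finset.mem_union_left _ (hxA j)
        · exact hzB _
      · intro hh
        obtain ⟨-, h1, h2⟩ := mk_mem_edgesIn.1 hh
        simp only [hJ, hI, Finset.mem_filter, Finset.mem_univ, true_and] at hj
        split_ifs at h2 with h
        · rw [← h] at hj
          exact hj.elim (fun hj => hj h1) fun hj => hj h1
        · exact hj.elim (fun hj => hj h1) fun hj => hj h2)
  have hIJ := mul_card_le_of_touching hpq J I (fun j hj => by simpa [hJ] using hj)
  have hq : (0 : ℝ) < q := by exact_mod_cast (Nat.zero_le p).trans_lt hpq
  have hIJ' : (q : ℝ) * I.card ≤ p * J.card := by exact_mod_cast hIJ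
  have hedge' : (edgeCount (graphOf M) A : ℝ) + J.card ≤ edgeCount (graphOf M) (A ∪ I.image z) := by
    exact_mod_cast hedge
  rw [predim, predim, hcard] at hpos
  push_cast at hpos
  have h1 : (p : ℝ) / q * (edgeCount (graphOf M) A + J.card)
      ≤ p / q * edgeCount (graphOf M) (A ∪ I.image z) :=
    mul_le_mul_of_nonneg_left hedge' (by positivity)
  have h2 : (I.card : ℝ) ≤ p / q * J.card := by
    rw [div_mul_eq_mul_div, le_div_iff₀ hq]; linarith
  rw [mul_add] at h1
  linarith

/-- The bases `x` and `y` carry gadgets whose first nodes are `S`-related. -/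
def AreCoded (p : ℕ) [NeZero p] (x y : Fin q → M) : Prop :=
  ∃ z z' : Fin p → M, IsGadget x z ∧ IsGadget y z' ∧ clsRel (z 0) (z' 0)

theorem adjRel_map_iff {B : Type} [LStar.Structure B] (g : B ↪[LStar] M) (u v : B) :
    adjRel (g u) (g v) ↔ adjRel u v := by
  have h := g.map_rel (GSRel.adj : LStar.Relations 2) ![u, v]
  have e : g ∘ ![u, v] = ![g u, g v] := by ext i; fin_cases i <;> rfl
  rwa [e] at h

theorem clsRel_map_iff {B : Type} [LStar.Structure B] (g : B ↪[LStar] M) (u v : B) :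
    clsRel (g u) (g v) ↔ clsRel u v := by
  have h := g.map_rel (GSRel.cls : LStar.Relations 2) ![u, v]
  have e : g ∘ ![u, v] = ![g u, g v] := by ext i; fin_cases i <;> rfl
  rwa [e] at h

open GadgetVertex in
-- By `IsGadget.mem` both witnesses lie in the strong image. There a first node is adjacent to base
-- point `0`, so it is a node over the right base, and `S` links nodes over different bases only
-- along edges of `R`.
theorem areCoded_base_iff (hpq : p < q) {C : Type} [Finite C] {R : SimpleGraph C}
    (g : GadgetVertex R p q ↪[LStar] M)
    (hg : IsStrongIn ((p : ℝ) / q) (Finset.univ.map g.toEmbedding)) {c d : C} (hcd : c ≠ d) :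
    AreCoded p (fun j : Fin q => g (base c j)) (fun j => g (base d j)) ↔ R.Adj c d := by
  have : NeZero q := ⟨by omega⟩
  constructor
  · have key : ∀ (c : C) (z : Fin p → M), IsGadget (fun j : Fin q => g (base c j)) z →
        ∃ d i, z 0 = g (node c d i) := by
      intro c z hz
      have hmem := hz.mem hpq hg (fun a b hab => by simpa using g.injective hab)
        (fun j => Finset.mem_map_of_mem _ (Finset.mem_univ _)) 0
      obtain ⟨w, -, hw⟩ := Finset.mem_map.1 hmem
      have hadj := hz.2.2 0
      -- Since `p < q`, edge `0` touches only node `0`, so its other end is a base point.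
      rw [lowNode_zero, highNode_zero hpq, if_pos rfl, ← hw] at hadj
      obtain ⟨d, i, rfl⟩ := exists_node_of_adj_base ((adjRel_map_iff g w (base c 0)).1 hadj)
      exact ⟨d, i, hw.symm⟩
    rintro ⟨z, z', hz, hz', hS⟩
    obtain ⟨d', i, hi⟩ := key c z hz
    obtain ⟨c', i', hi'⟩ := key d z' hz'
    rw [hi, hi', clsRel_map_iff, clsRel_iff] at hS
    rcases hS with ⟨h, -⟩ | ⟨h, h', -⟩
    · exact absurd h hcd
    · exact h' ▸ h
  · intro h
    have key : ∀ c d : C, IsGadget (fun j : Fin q => g (base c j))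
        (fun i : Fin p => g (node c d i)) := by
      refine fun c d => ⟨fun i i' hne hh => hne ?_, fun i j hh => ?_, fun j => ?_⟩
      · simpa using g.injective hh
      · simpa using g.injective hh
      · rw [← apply_ite g, adjRel_map_iff]
        exact Or.inl ⟨c, d, j, rfl, rfl⟩
    refine ⟨_, _, key c d, key d c, ?_⟩
    rw [clsRel_map_iff]
    exact Or.inr ⟨h, rfl, rfl, rfl⟩

open FirstOrder FirstOrder.Language

theorem definable_adjRel {β : Type} (a b : β) :
    (∅ : Set M).Definable LStar {v : β → M | adjRel (v a) (v b)} :=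
  Set.empty_definable_iff.2 ⟨Relations.formula₂ (L := LStar) GSRel.adj (Term.var a) (Term.var b), by
    ext v
    exact (Formula.realize_rel₂ (L := LStar) (R := GSRel.adj) (t₁ := Term.var a) (t₂ := Term.var b)
      (v := v)).symm⟩

theorem definable_clsRel {β : Type} (a b : β) :
    (∅ : Set M).Definable LStar {v : β → M | clsRel (v a) (v b)} :=
  Set.empty_definable_iff.2 ⟨Relations.formula₂ (L := LStar) GSRel.cls (Term.var a) (Term.var b), by
    ext v
    exact (Formula.realize_rel₂ (L := LStar) (R := GSRel.cls) (t₁ := Term.var a) (t₂ := Term.var b)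
      (v := v)).symm⟩

theorem definable_ne {β : Type} (a b : β) :
    (∅ : Set M).Definable LStar {v : β → M | v a ≠ v b} :=
  Set.empty_definable_iff.2 ⟨(Term.equal (Term.var a) (Term.var b)).not, by
    ext v
    simp only [Set.mem_ofPred_eq, Formula.realize_not, Formula.realize_equal, Term.realize_var]⟩

theorem definable_isGadget {β : Type} (x : Fin q → β) (z : Fin p → β) :
    (∅ : Set M).Definable LStar {v : β → M | IsGadget (v ∘ x) (v ∘ z)} := by
  have : {v : β → M | IsGadget (v ∘ x) (v ∘ z)} =
      (⋂ i, ⋂ i', {v | i ≠ i' → v (z i) ≠ v (z i')}) ∩ ((⋂ i, ⋂ j, {v | v (z i) ≠ v (x j)}) ∩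
        ⋂ j : Fin q, {v | adjRel (v (z (lowNode j)))
          (v (if lowNode (p := p) j = highNode j then x j else z (highNode j)))}) := by
    ext v
    simp only [IsGadget, Set.mem_ofPred_eq, Set.mem_inter_iff, Set.mem_iInter, Function.comp_apply,
      apply_ite v]
  rw [this]
  refine .inter (Set.definable_iInter_of_finite fun i => Set.definable_iInter_of_finite fun i' => ?_)
    (.inter (Set.definable_iInter_of_finite fun i => Set.definable_iInter_of_finite fun j =>
      definable_ne _ _) (Set.definable_iInter_of_finite fun j => definable_adjRel _ _))
  by_cases h : i = i'
  · simp [h]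
  · simpa [h] using definable_ne (z i) (z i')

theorem exists_formula_areCoded (p q : ℕ) [NeZero p] (M : Type) [LStar.Structure M] :
    ∃ φ : LStar.Formula (Fin q ⊕ Fin q), ∀ v : Fin q ⊕ Fin q → M,
      φ.Realize v ↔ AreCoded p (v ∘ Sum.inl) (v ∘ Sum.inr) := by
  have h : (∅ : Set M).Definable LStar
      {v : (Fin q ⊕ Fin q) ⊕ (Fin p ⊕ Fin p) → M |
        IsGadget (v ∘ Sum.inl ∘ Sum.inl) (v ∘ Sum.inr ∘ Sum.inl) ∧
        IsGadget (v ∘ Sum.inl ∘ Sum.inr) (v ∘ Sum.inr ∘ Sum.inr) ∧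
        clsRel (v (Sum.inr (Sum.inl 0))) (v (Sum.inr (Sum.inr 0)))} :=
    .inter (definable_isGadget _ _) (.inter (definable_isGadget _ _) (definable_clsRel _ _))
  -- Restricting assignments to the free variables is existential quantification over the two
  -- gadgets.
  obtain ⟨φ, hφ⟩ := Set.empty_definable_iff.1 (h.image_comp Sum.inl)
  refine ⟨φ, fun v => ?_⟩
  have hv : v ∈ Set.ofPred φ.Realize ↔ φ.Realize v := Iff.rfl
  rw [← hv, ← hφ]
  constructor
  · rintro ⟨w, ⟨h1, h2, h3⟩, rfl⟩
    exact ⟨_, _, h1, h2, h3⟩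
  · rintro ⟨z, z', h1, h2, h3⟩
    exact ⟨Sum.elim v (Sum.elim z z'), ⟨h1, h2, h3⟩, rfl⟩

end Coding

/-! ### Independence property and instability -/

theorem FormulaHasIP.formulaHasOP {L : FirstOrder.Language.{0, 0}} {T : L.Theory} {k l : ℕ}
    {φ : L.Formula (Fin k ⊕ Fin l)} (h : FormulaHasIP T φ) : FormulaHasOP T φ := by
  intro n
  obtain ⟨M, a, b, hab⟩ := h n
  -- The final segments `{j | i < j}` turn independence into order.
  exact ⟨M, fun i => a {j | i < j}, b, fun i j => hab _ _⟩

theorem HasIndependenceProperty.not_isStableTheory {L : FirstOrder.Language.{0, 0}} {T : L.Theory}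
    (h : HasIndependenceProperty T) : ¬ IsStableTheory T := by
  obtain ⟨k, l, φ, hφ⟩ := h
  exact fun hs => hs k l φ hφ.formulaHasOP

theorem IsGeneric.hasIndependenceProperty {p q N : ℕ} (hp : 0 < p) (hpq : p < q)
    (hco : p.Coprime q) (hN : q < N) {μ : GraphPairFun} (hμ : IsMuFunction ((p : ℝ) / q) μ)
    {M : Type} [LStar.Structure M] (hM : IsGeneric ((p : ℝ) / q) N μ M) :
    HasIndependenceProperty (LStar.completeTheory M) := by
  have : NeZero p := ⟨hp.ne'⟩
  obtain ⟨φ, hφ⟩ := exists_formula_areCoded p q M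
  refine ⟨q, q, φ, fun n => ?_⟩
  -- The bipartite membership graph between subsets and elements.
  let R : SimpleGraph (Set (Fin n) ⊕ Fin n) := SimpleGraph.fromRel fun u v =>
    ∃ η i, u = Sum.inl η ∧ v = Sum.inr i ∧ i ∈ η
  obtain ⟨g, hg⟩ := hM.exists_strong_embedding
    (GadgetVertex.isAdmissible (R := R) hpq hco hN hμ Finset.univ)
  have : Nonempty M := ⟨g (.base (Sum.inl ∅) ⟨0, by omega⟩)⟩
  refine ⟨.of (LStar.completeTheory M) M, fun η j => g (.base (Sum.inl η) j),
    fun i j => g (.base (Sum.inr i) j), fun η i => ?_⟩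
  refine (hφ _).trans ((areCoded_base_iff hpq g hg Sum.inl_ne_inr).trans ?_)
  simp [R]

theorem mainTheorem7 (r : ℚ) (hr₀ : 0 < r) (hr₁ : r < 1) :
    ∃ N_r : ℕ, ∀ N : ℕ, 1 < N → N_r < N →
      ∀ μ : GraphPairFun, IsMuFunction (r : ℝ) μ →
        ∀ (M : Type) [LStar.Structure M], IsGeneric (r : ℝ) N μ M →
          HasIndependenceProperty (LStar.completeTheory M) ∧
            ¬ IsStableTheory (LStar.completeTheory M) := by
  have hnum : (r.num.natAbs : ℤ) = r.num := Int.natAbs_of_nonneg (Rat.num_pos.2 hr₀).le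
  have hr : (r : ℝ) = (r.num.natAbs : ℝ) / r.den := by
    rw [Rat.cast_def, ← hnum]; simp
  have hp : 0 < r.num.natAbs := Int.natAbs_pos.2 (Rat.num_pos.2 hr₀).ne'
  have hpq : r.num.natAbs < r.den := by
    have := Rat.num_lt_denom_iff.2 hr₁
    omega
  -- `S`-classes of the coding structure have at most `q = r.den` elements, so `q < N` is what
  -- admissibility requires.
  refine ⟨r.den, fun N _ hN μ hμ M _ hM => ?_⟩
  rw [hr] at hμ hM
  have h := hM.hasIndependenceProperty hp hpq r.reduced hN hμ
  exact ⟨h, h.not_isStableTheory⟩
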